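/- Let $\mathbf{S}$ be the category of simplicial sets with its standard (Kan–Quillen) model structure, and let $\mathbf{S}\text{-}\mathbf{Cat}$ be the category of small simplicial categories (small categories enriched in $\mathbf{S}$) and simplicial functors. For a simplicial category $\mathcal{A}$ let $[\mathcal{A}]$ be the category with the same objects and with $[\mathcal{A}](x,y)=\pi_0\mathcal{A}(x,y)$. A simplicial functor $f:\mathcal{A}\to\mathcal{B}$ is a *trivial fibration* if every map $f_{x,y}:\mathcal{A}(x,y)\to\mathcal{B}(f(x),f(y))$ is both a Kan fibration and a weak equivalence and the functor $[f]:[\mathcal{A}]\to[\mathcal{B}]$ is both an isofibration and essentially surjective. (A functor $g:C\to D$ is an isofibration if for every object $x$ of $C$ and every isomorphism $v:y'\to g(x)$ of $D$ there is an isomorphism $u:x'\to x$ of $C$ with $g(u)=v$.) A simplicial functor is a *cofibration* if it has the left lifting property with respect to all trivial fibrations, and $\mathcal{A}$ is *cofibrant* if $\emptyset\to\mathcal{A}$ is a cofibration. A map of simplicial monoids (monoids in $(\mathbf{S},\times)$) is a *trivial fibration* if its underlying map of simplicial sets is both a Kan fibration and a weak equivalence; it is a *cofibration* if it has the left lifting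 property with respect to all trivial fibrations of simplicial monoids; a simplicial monoid is *cofibrant* if the map to it from the initial simplicial monoid is a cofibration. **Lemma 2.4.** Let $\mathcal{A}$ be a cofibrant simplicial category. Then for each object $a$ of $\mathcal{A}$ the endomorphism simplicial monoid $\mathcal{A}(a,a)$, with multiplication the composition of $\mathcal{A}$ and unit $\mathrm{id}_a$, is cofibrant. -/

import Mathlib

open CategoryTheory MonoidalCategory HomotopicalAlgebra Opposite Simplicial
open scoped SSet.modelCategoryQuillen

universe u

/-! ### Simplicial sets

Mathlib provides the cofibrations (monomorphisms) and the fibrations (Kan fibrations) of the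
standard model structure on simplicial sets. We add its weak equivalences. -/

/-- The weak equivalences of the standard (Kan-Quillen) model structure on simplicial sets.
The acyclic cofibrations of this structure are the anodyne extensions (the maps with the left
lifting property against Kan fibrations), its acyclic fibrations are the maps with the right
lifting property against the boundary inclusions `∂Δ[n] ⟶ Δ[n]`, and a map is a weak equivalence
if and only if it is an acyclic cofibration followed by an acyclic fibration. -/
instance sSetWeakEquivalences : CategoryWithWeakEquivalences SSet.{u} where
  weakEquivalences := fun X Y f =>
    ∃ (Z : SSet.{u}) (i : X ⟶ Z) (p : Z ⟶ Y),
      SSet.anodyneExtensions i ∧ SSet.modelCategoryQuillen.I.rlp p ∧ i ≫ p = f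

/-! ### The category of small simplicial categories -/

/-- A small simplicial category: a (small) set of objects, with a category structure enriched in
simplicial sets. -/
structure SCat : Type (u + 1) where
  /-- The set of objects. -/
  Obj : Type u
  /-- The enrichment in simplicial sets. -/
  [enriched : EnrichedCategory SSet.{u} Obj]

namespace SCat

instance : CoeSort SCat.{u} (Type u) := ⟨SCat.Obj⟩

attribute [instance] SCat.enriched

/-- The simplicial set of morphisms from `x` to `y`. -/
abbrev hom (A : SCat.{u}) (x y : A) : SSet.{u} := EnrichedCategory.Hom x y

/-- Simplicial categories and simplicial functors form a category. -/
instance : Category SCat.{u} where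
  Hom A B := EnrichedFunctor SSet.{u} A B
  id A := EnrichedFunctor.id SSet.{u} A
  comp F G := EnrichedFunctor.comp SSet.{u} F G
  id_comp _ := EnrichedFunctor.ext _ (fun _ => rfl)
    (fun _ _ => (Category.comp_id _).trans (Category.id_comp _))
  comp_id _ := EnrichedFunctor.ext _ (fun _ => rfl)
    (fun _ _ => (Category.comp_id _).trans (Category.comp_id _))
  assoc _ _ _ := EnrichedFunctor.ext _ (fun _ => rfl)
    (fun _ _ => (Category.comp_id _).trans (Category.assoc _ _ _))

/-- The action of a simplicial functor on objects. -/
abbrev onObj {A B : SCat.{u}} (F : A ⟶ B) (x : A) : B := EnrichedFunctor.obj F x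

/-- The action `A(x, y) ⟶ B(F x, F y)` of a simplicial functor on morphisms. -/
abbrev onHom {A B : SCat.{u}} (F : A ⟶ B) (x y : A) :
    A.hom x y ⟶ B.hom (onObj F x) (onObj F y) := EnrichedFunctor.map F x y

/-- The empty simplicial category. -/
def empty : SCat.{u} where
  Obj := PEmpty.{u + 1}
  enriched :=
    { Hom := fun x => x.elim
      id := fun x => x.elim
      comp := fun x => x.elim
      id_comp := fun x => x.elim
      comp_id := fun x => x.elim
      assoc := fun x => x.elim }

instance (A : SCat.{u}) : Unique (empty.{u} ⟶ A) where
  default :=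
    { obj := fun x => PEmpty.elim x
      map := fun x => PEmpty.elim x
      map_id := fun x => PEmpty.elim x
      map_comp := fun x => PEmpty.elim x }
  uniq _ := EnrichedFunctor.ext _ (fun x => PEmpty.elim x) (fun x => PEmpty.elim x)

instance : Limits.HasInitial SCat.{u} := Limits.hasInitial_of_unique empty

/-! ### The category of components -/

/-- The objects of the category of components of a simplicial category. -/
structure Components (A : SCat.{u}) : Type u where
  /-- The underlying object of the simplicial category. -/
  as : A

/-- The identity of `x`, as a vertex of `A(x, x)`. -/
def idVertex (A : SCat.{u}) (x : A) : (A.hom x x) _⦋0⦌ :=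
  (eId SSet.{u} x).app (op ⦋0⦌) PUnit.unit

/-- A pair of `n`-simplices, as an `n`-simplex of the product. -/
abbrev simplexPair {X Y : SSet.{u}} {n : SimplexCategoryᵒᵖ} (f : X.obj n) (g : Y.obj n) :
    (X ⊗ Y).obj n := ⟨f, g⟩

/-- Composition of `n`-simplices, in diagrammatic order. -/
def compSimplex (A : SCat.{u}) {x y z : A} {n : SimplexCategoryᵒᵖ}
    (f : (A.hom x y).obj n) (g : (A.hom y z).obj n) : (A.hom x z).obj n :=
  (eComp SSet.{u} x y z).app n (simplexPair f g)

lemma map_compSimplex (A : SCat.{u}) {x y z : A} {m n : SimplexCategoryᵒᵖ} (α : m ⟶ n)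
    (f : (A.hom x y).obj m) (g : (A.hom y z).obj m) :
    (A.hom x z).map α (A.compSimplex f g) =
      A.compSimplex ((A.hom x y).map α f) ((A.hom y z).map α g) :=
  (NatTrans.naturality_apply (eComp SSet.{u} x y z) α
    (simplexPair (X := A.hom x y) (Y := A.hom y z) f g)).symm

lemma idVertex_comp (A : SCat.{u}) {x y : A} (f : (A.hom x y) _⦋0⦌) :
    A.compSimplex (A.idVertex x) f = f :=
  ConcreteCategory.congr_hom (congr_app (e_id_comp SSet.{u} x y) (op ⦋0⦌)) f

lemma comp_idVertex (A : SCat.{u}) {x y : A} (f : (A.hom x y) _⦋0⦌) :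
    A.compSimplex f (A.idVertex y) = f :=
  ConcreteCategory.congr_hom (congr_app (e_comp_id SSet.{u} x y) (op ⦋0⦌)) f

lemma compSimplex_assoc (A : SCat.{u}) {w x y z : A} {n : SimplexCategoryᵒᵖ}
    (f : (A.hom w x).obj n) (g : (A.hom x y).obj n) (h : (A.hom y z).obj n) :
    A.compSimplex (A.compSimplex f g) h = A.compSimplex f (A.compSimplex g h) :=
  ConcreteCategory.congr_hom (congr_app (e_assoc SSet.{u} w x y z) n)
    (simplexPair (X := A.hom w x) (Y := A.hom x y ⊗ A.hom y z) f
      (simplexPair (X := A.hom x y) (Y := A.hom y z) g h))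

/-- The composite of two edges in simplicial sets of morphisms. -/
def compEdge (A : SCat.{u}) {x y z : A} {f₀ f₁ : (A.hom x y) _⦋0⦌} {g₀ g₁ : (A.hom y z) _⦋0⦌}
    (e : (A.hom x y).Edge f₀ f₁) (e' : (A.hom y z).Edge g₀ g₁) :
    (A.hom x z).Edge (A.compSimplex f₀ g₀) (A.compSimplex f₁ g₁) :=
  SSet.Edge.mk (A.compSimplex e.edge e'.edge)
    ((A.map_compSimplex _ _ _).trans (congrArg₂ A.compSimplex e.src_eq e'.src_eq))
    ((A.map_compSimplex _ _ _).trans (congrArg₂ A.compSimplex e.tgt_eq e'.tgt_eq))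

/-- Composition of connected components of the simplicial sets of morphisms. -/
def compComponents (A : SCat.{u}) {x y z : A} (f : (A.hom x y).π₀) (g : (A.hom y z).π₀) :
    (A.hom x z).π₀ :=
  SSet.π₀.lift
    (fun f₀ => SSet.π₀.lift (fun g₀ => SSet.π₀.mk (A.compSimplex f₀ g₀))
      (fun _ _ e => SSet.π₀.sound (A.compEdge (SSet.Edge.id f₀) e)) g)
    (fun f₀ f₁ e => by
      obtain ⟨g₀, rfl⟩ := g.mk_surjective
      exact SSet.π₀.sound (A.compEdge e (SSet.Edge.id g₀))) f

/-- The category of components of a simplicial category `A`: it has the objects of `A`, and its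
morphisms from `x` to `y` are the connected components of `A(x, y)`, that is, the morphisms from
the point to `A(x, y)` in the homotopy category of simplicial sets. -/
instance (A : SCat.{u}) : Category.{u} A.Components where
  Hom x y := (A.hom x.as y.as).π₀
  id x := SSet.π₀.mk (A.idVertex x.as)
  comp f g := A.compComponents f g
  id_comp f := by
    obtain ⟨f, rfl⟩ := SSet.π₀.mk_surjective f
    exact congrArg SSet.π₀.mk (A.idVertex_comp f)
  comp_id f := by
    obtain ⟨f, rfl⟩ := SSet.π₀.mk_surjective f
    exact congrArg SSet.π₀.mk (A.comp_idVertex f)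
  assoc f g h := by
    obtain ⟨f, rfl⟩ := SSet.π₀.mk_surjective f
    obtain ⟨g, rfl⟩ := SSet.π₀.mk_surjective g
    obtain ⟨h, rfl⟩ := SSet.π₀.mk_surjective h
    exact congrArg SSet.π₀.mk (A.compSimplex_assoc f g h)

lemma onHom_idVertex {A B : SCat.{u}} (F : A ⟶ B) (x : A) :
    (onHom F x x).app (op ⦋0⦌) (A.idVertex x) = B.idVertex (onObj F x) :=
  ConcreteCategory.congr_hom (congr_app (EnrichedFunctor.map_id F x) (op ⦋0⦌)) PUnit.unit

lemma onHom_compSimplex {A B : SCat.{u}} (F : A ⟶ B) {x y z : A} {n : SimplexCategoryᵒᵖ}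
    (f : (A.hom x y).obj n) (g : (A.hom y z).obj n) :
    (onHom F x z).app n (A.compSimplex f g) =
      B.compSimplex ((onHom F x y).app n f) ((onHom F y z).app n g) :=
  ConcreteCategory.congr_hom (congr_app (EnrichedFunctor.map_comp F x y z) n)
    (simplexPair (X := A.hom x y) (Y := A.hom y z) f g)

/-- The functor induced by a simplicial functor on the categories of components. -/
def componentsMap {A B : SCat.{u}} (F : A ⟶ B) : A.Components ⥤ B.Components where
  obj x := ⟨onObj F x.as⟩
  map {x y} f := SSet.mapπ₀ (onHom F x.as y.as) f
  map_id x := congrArg SSet.π₀.mk (onHom_idVertex F x.as)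
  map_comp f g := by
    obtain ⟨f, rfl⟩ := SSet.π₀.mk_surjective f
    obtain ⟨g, rfl⟩ := SSet.π₀.mk_surjective g
    exact congrArg SSet.π₀.mk (onHom_compSimplex F f g)

/-! ### The model structure on simplicial categories -/

/-- A functor `F : C ⥤ D` is an isofibration if every isomorphism `v : y' ≅ F x` of `D` is the
image of some isomorphism `u : x' ≅ x` of `C` (so that, in particular, `F x' = y'`). -/
def IsIsofibration {C D : Type*} [Category* C] [Category* D] (F : C ⥤ D) : Prop :=
  ∀ (x : C) (y' : D) (v : y' ≅ F.obj x),
    ∃ (x' : C) (u : x' ≅ x) (h : F.obj x' = y'), F.map u.hom = eqToHom h ≫ v.hom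

/-- A simplicial functor is locally in a class `K` of maps of simplicial sets if all the maps
`A(x, y) ⟶ B(F x, F y)` are in `K`. -/
def locally (K : MorphismProperty SSet.{u}) : MorphismProperty SCat.{u} :=
  fun A _ F => ∀ x y : A, K (onHom F x y)

/-- The weak equivalences of simplicial categories are the Dwyer-Kan equivalences: the functors
that are locally weak equivalences and essentially surjective on categories of components. -/
instance : CategoryWithWeakEquivalences SCat.{u} where
  weakEquivalences := fun _ _ F =>
    locally (weakEquivalences SSet.{u}) F ∧ (componentsMap F).EssSurj

/-- The fibrations of simplicial categories are the Dwyer-Kan fibrations: the functors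
that are locally Kan fibrations and induce an isofibration on categories of components. -/
instance : CategoryWithFibrations SCat.{u} where
  fibrations := fun _ _ F =>
    locally (fibrations SSet.{u}) F ∧ IsIsofibration (componentsMap F)

/-- The cofibrations of simplicial categories are the maps with the left lifting property with
respect to the trivial fibrations. -/
instance : CategoryWithCofibrations SCat.{u} where
  cofibrations := (trivialFibrations SCat.{u}).llp

end SCat

/-! ### The model structure on simplicial monoids -/

namespace SMon

/-- A map of simplicial monoids is a weak equivalence if it is one of simplicial sets. -/
instance : CategoryWithWeakEquivalences (Mon SSet.{u}) where
  weakEquivalences := (weakEquivalences SSet.{u}).inverseImage (Mon.forget SSet.{u})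

/-- A map of simplicial monoids is a fibration if it is one of simplicial sets. -/
instance : CategoryWithFibrations (Mon SSet.{u}) where
  fibrations := (fibrations SSet.{u}).inverseImage (Mon.forget SSet.{u})

/-- The cofibrations of simplicial monoids are the maps with the left lifting property with
respect to the trivial fibrations. -/
instance : CategoryWithCofibrations (Mon SSet.{u}) where
  cofibrations := (trivialFibrations (Mon SSet.{u})).llp

end SMon

/-- The endomorphism simplicial monoid `A(a, a)` of an object of a simplicial category: its unit
and multiplication are the identity and the composition of `A`. -/
def SCat.endMon (A : SCat.{u}) (a : A) : Mon SSet.{u} where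
  X := A.hom a a
  mon :=
    { one := eId SSet.{u} a
      mul := eComp SSet.{u} a a a
      one_mul := (Iso.inv_comp_eq _).mp (e_id_comp SSet.{u} a a) |>.trans (Category.comp_id _)
      mul_one := (Iso.inv_comp_eq _).mp (e_comp_id SSet.{u} a a) |>.trans (Category.comp_id _)
      mul_assoc := (e_assoc' SSet.{u} a a a a).symm }

/-! Pulling a lifting problem back along its lower map reduces the theorem to this: every monoid map
`π : N ⟶ A(a, a)` that is a trivial fibration of simplicial sets has a section.

Through `π` and precomposition, every `A(a, x)` is a left `N`-module, and postcomposition by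
morphisms of `A` is `N`-linear. Choose cofibrant resolutions `P x` of these modules, taking for `P
a` the free module `N` with augmentation `π`. Let `resolved` be the simplicial category with the
objects of `A`, whose morphisms from `x` to `y` are pairs of a morphism of `A` and a linear map `P x
⟶ P y` covering it.

Its projection to `A` is the identity on objects, and is locally a trivial fibration because `P x`
is cofibrant and `P y ⟶ A(a, y)` is a trivial fibration (`I_rlp_resolvedProj`). Cofibrancy of `A`
therefore gives a section. Linear endomorphisms of the free module `N` are right multiplications, so
the endomorphism monoid of `a` in `resolved` maps to `N` over `A(a, a)` (`resolvedEndHom_comp`). The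
section at `a`, followed by this map, splits `π`.

The technical core is `Cofibrant.exists_lift`: the lifting property of a cofibrant module, stated
for single maps, implies its simplicially enriched form relative to an inclusion of parameters. -/

namespace SSet

/-! ### Trivial fibrations of simplicial sets and their effect on components. -/

open modelCategoryQuillen in
lemma I_rlp_le_fibrations : I.{u}.rlp ≤ fibrations SSet.{u} := by
  rw [← rlp_monomorphisms, fibrations_eq]
  exact MorphismProperty.antitone_rlp J_le_monomorphisms

open modelCategoryQuillen in
lemma I_rlp_le_weakEquivalences : I.{u}.rlp ≤ weakEquivalences SSet.{u} := by
  intro X Y p hp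
  refine ⟨X, 𝟙 X, p, ?_, hp, Category.id_comp _⟩
  rw [anodyneExtensions_eq_llp_rlp]
  exact MorphismProperty.llp_of_isIso _ _

-- Retract argument: a Kan fibration lifts against the anodyne factor of its factorization, so it is
-- a retract of the other factor.
open modelCategoryQuillen in
lemma trivialFibrations_eq : trivialFibrations SSet.{u} = I.rlp := by
  ext X Y p
  refine ⟨?_, fun hp => ⟨I_rlp_le_fibrations p hp, I_rlp_le_weakEquivalences p hp⟩⟩
  rintro ⟨hf, Z, i, q, hi, hq, rfl⟩
  rw [anodyneExtensions_eq_llp_rlp] at hi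
  have := hi _ hf
  exact MorphismProperty.of_retract (RetractArrow.ofRightLiftingProperty rfl) hq

/-- The map from a discrete simplicial set given by a family of vertices. -/
def constDesc {T : Type u} {X : SSet.{u}} (f : T → X _⦋0⦌) :
    (Functor.const SimplexCategoryᵒᵖ).obj T ⟶ X where
  app n := ↾fun t => X.map (SimplexCategory.const n.unop ⦋0⦌ 0).op (f t)
  naturality m n α := by
    ext t
    change _ = X.map α (X.map _ _)
    rw [← Functor.map_comp_apply]
    rfl

lemma constDesc_app_zero {T : Type u} {X : SSet.{u}} (f : T → X _⦋0⦌) (t : T) :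
    (constDesc f).app (op ⦋0⦌) t = f t := by
  change X.map _ (f t) = f t
  rw [SimplexCategory.const_eq_id, op_id, Functor.map_id_apply]

lemma constDesc_comp {T : Type u} {X Y : SSet.{u}} (f : T → X _⦋0⦌) (p : X ⟶ Y) :
    constDesc f ≫ p = constDesc (fun t => p.app _ (f t)) := by
  ext n t
  exact NatTrans.naturality_apply p _ _

instance mono_constDesc_obj₀Equiv (n : ℕ) :
    Mono (constDesc (fun t : ULift.{u} (Fin (n + 1)) => stdSimplex.obj₀Equiv.{u}.symm t.down)) := by
  have : ∀ m, Mono ((constDesc (fun t : ULift.{u} (Fin (n + 1)) =>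
      stdSimplex.obj₀Equiv.{u}.symm t.down)).app m) := by
    intro m
    rw [mono_iff_injective]
    intro s t h
    -- Restricting to a vertex reduces injectivity in each degree to degree zero.
    have h' := congrArg (Δ[n].map (SimplexCategory.const ⦋0⦌ m.unop 0).op) h
    simp only [← NatTrans.naturality_apply] at h'
    change (constDesc _).app (op ⦋0⦌) s = (constDesc _).app (op ⦋0⦌) t at h'
    rw [constDesc_app_zero, constDesc_app_zero] at h'
    exact ULift.ext _ _ (stdSimplex.obj₀Equiv.symm.injective h')
  exact NatTrans.mono_of_mono_app _

/-- Faces are indexed by the omitted vertex, so the index is swapped. -/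
lemma yonedaEquiv_symm_app_vertex_zero {X : SSet.{u}} (s : X _⦋1⦌) :
    (yonedaEquiv.symm s).app _ (stdSimplex.obj₀Equiv.symm 0) = X.δ 1 s := by
  have h : stdSimplex.objEquiv (stdSimplex.obj₀Equiv.{u}.symm (0 : Fin 2)) =
      SimplexCategory.δ 1 := by
    ext i
    fin_cases i
    rfl
  exact congrArg (fun f => X.map (Quiver.Hom.op f) s) h

lemma yonedaEquiv_symm_app_vertex_one {X : SSet.{u}} (s : X _⦋1⦌) :
    (yonedaEquiv.symm s).app _ (stdSimplex.obj₀Equiv.symm 1) = X.δ 0 s := by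
  have h : stdSimplex.objEquiv (stdSimplex.obj₀Equiv.{u}.symm (1 : Fin 2)) =
      SimplexCategory.δ 0 := by
    ext i
    fin_cases i
    rfl
  exact congrArg (fun f => X.map (Quiver.Hom.op f) s) h

section

variable {X Y : SSet.{u}} {p : X ⟶ Y} (hp : modelCategoryQuillen.I.rlp p)

include hp

lemma hasLiftingProperty_of_I_rlp {A B : SSet.{u}} (i : A ⟶ B) [Mono i] :
    HasLiftingProperty i p := by
  rw [← rlp_monomorphisms] at hp
  exact hp i (MorphismProperty.monomorphisms.infer_property i)

lemma exists_vertex_of_I_rlp (y : Y _⦋0⦌) : ∃ x : X _⦋0⦌, p.app _ x = y := by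
  have := hasLiftingProperty_of_I_rlp hp
    (Subcomplex.ι (⊥ : (Δ[0] : SSet.{u}).Subcomplex))
  have sq : CommSq (Subcomplex.isInitialBot.to X) (Subcomplex.ι (⊥ : (Δ[0] : SSet.{u}).Subcomplex))
    p (yonedaEquiv.symm y) := ⟨Subcomplex.isInitialBot.hom_ext _ _⟩
  refine ⟨yonedaEquiv sq.lift, ?_⟩
  rw [← yonedaEquiv_comp, sq.fac_right, Equiv.apply_symm_apply]

/-- Lift against the inclusion of the two endpoints in `Δ[1]`, with the endpoints presented as a
discrete simplicial set. -/
lemma nonempty_edge_of_I_rlp {x₀ x₁ : X _⦋0⦌} (e : Y.Edge (p.app _ x₀) (p.app _ x₁)) :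
    Nonempty (X.Edge x₀ x₁) := by
  have := hasLiftingProperty_of_I_rlp hp
    (constDesc (fun t : ULift.{u} (Fin 2) => stdSimplex.obj₀Equiv.{u}.symm t.down))
  have sq : CommSq (constDesc (fun t : ULift.{u} (Fin 2) => ![x₀, x₁] t.down))
      (constDesc (fun t : ULift.{u} (Fin 2) => stdSimplex.obj₀Equiv.{u}.symm t.down)) p
      (yonedaEquiv.symm e.edge) := ⟨by
    rw [constDesc_comp, constDesc_comp]
    congr 1
    funext ⟨t⟩
    fin_cases t
    · exact e.src_eq.symm.trans (yonedaEquiv_symm_app_vertex_zero e.edge).symm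
    · exact e.tgt_eq.symm.trans (yonedaEquiv_symm_app_vertex_one e.edge).symm⟩
  have h : ∀ t : Fin 2, sq.lift.app _ (stdSimplex.obj₀Equiv.symm t) = ![x₀, x₁] t := fun t => by
    have := ConcreteCategory.congr_hom (congr_app sq.fac_left (op ⦋0⦌)) ⟨t⟩
    rw [constDesc_app_zero] at this
    refine Eq.trans ?_ this
    exact congrArg (sq.lift.app _) (constDesc_app_zero
      (fun t : ULift.{u} (Fin 2) => stdSimplex.obj₀Equiv.{u}.symm t.down) ⟨t⟩).symm
  refine ⟨Edge.mk (yonedaEquiv sq.lift) ?_ ?_⟩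
  · refine Eq.trans ?_ (h 0)
    rw [← yonedaEquiv_symm_app_vertex_zero, Equiv.symm_apply_apply]
  · refine Eq.trans ?_ (h 1)
    rw [← yonedaEquiv_symm_app_vertex_one, Equiv.symm_apply_apply]

/-- A zigzag of edges in the base lifts edge by edge. Arbitrary lifts of the endpoints are allowed,
so that the lifted pieces can be joined. -/
lemma mapπ₀_injective_of_I_rlp : Function.Injective (mapπ₀ p) := by
  have key : ∀ y y' : Y _⦋0⦌, Relation.EqvGen π₀Rel y y' → ∀ x x' : X _⦋0⦌,
      p.app _ x = y → p.app _ x' = y' → π₀.mk x = π₀.mk x' := by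
    intro y y' h
    induction h with
    | rel y y' h =>
      rintro x x' rfl rfl
      obtain ⟨e⟩ := nonempty_edge_of_I_rlp hp h.some
      exact π₀.sound e
    | refl y =>
      rintro x x' rfl h
      -- Two points of one fibre are joined by a lift of the degenerate edge.
      obtain ⟨e⟩ := nonempty_edge_of_I_rlp hp ((Edge.id _).ofEq rfl h.symm)
      exact π₀.sound e
    | symm _ _ _ ih => exact fun x x' h h' => (ih x' x h' h).symm
    | trans _ y _ _ _ ih ih' =>
      intro x x' h h'
      obtain ⟨x₁, hx₁⟩ := exists_vertex_of_I_rlp hp y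
      exact (ih x x₁ h hx₁).trans (ih' x₁ x' hx₁ h')
  intro a b h
  induction a with | _ a
  induction b with | _ b
  rw [mapπ₀_mk, mapπ₀_mk, π₀.mk_eq_mk_iff] at h
  exact key _ _ h _ _ rfl rfl

lemma mapπ₀_surjective_of_I_rlp : Function.Surjective (mapπ₀ p) := by
  intro b
  induction b with | _ b
  obtain ⟨a, rfl⟩ := exists_vertex_of_I_rlp hp b
  exact ⟨π₀.mk a, rfl⟩

end

end SSet

lemma Functor.isIsofibration_of_full_of_faithful {C D : Type*} [Category* C] [Category* D]
    (F : C ⥤ D) [F.Full] [F.Faithful] (h : Function.Surjective F.obj) : SCat.IsIsofibration F := by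
  intro x y' v
  obtain ⟨x', rfl⟩ := h y'
  exact ⟨x', F.preimageIso v, rfl, by simp⟩

/-! ### A criterion for trivial fibrations of simplicial categories. -/

namespace SCat

lemma trivialFibrations_of_locally {A B : SCat.{u}} {F : A ⟶ B}
    (hF : locally SSet.modelCategoryQuillen.I.rlp F) (h : Function.Surjective (onObj F)) :
    trivialFibrations SCat.{u} F := by
  have : (componentsMap F).Full :=
    ⟨fun {x y} => SSet.mapπ₀_surjective_of_I_rlp (hF x.as y.as)⟩
  have : (componentsMap F).Faithful :=
    ⟨fun {x y} => @(SSet.mapπ₀_injective_of_I_rlp (hF x.as y.as))⟩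
  have h' : Function.Surjective (componentsMap F).obj := fun ⟨y⟩ => by
    obtain ⟨x, rfl⟩ := h y
    exact ⟨⟨x⟩, rfl⟩
  refine ⟨⟨fun x y => SSet.I_rlp_le_fibrations _ (hF x y),
    Functor.isIsofibration_of_full_of_faithful _ h'⟩,
    fun x y => SSet.I_rlp_le_weakEquivalences _ (hF x y), ⟨fun y => ?_⟩⟩
  obtain ⟨x, rfl⟩ := h' y
  exact ⟨x, ⟨Iso.refl _⟩⟩

end SCat

/-! ### Modules over simplicial monoids -/

/-- The category such that the presheaves on it are the simplicial sets with an action of the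
simplicial monoid `M`: its objects are those of the simplex category, and a morphism is a morphism
of the simplex category together with a simplex of `M` of the dimension of its source. -/
structure ActionIndex (M : SimplexCategoryᵒᵖ ⥤ MonCat.{u}) where
  /-- The underlying object of the simplex category. -/
  as : SimplexCategory

namespace ActionIndex

variable {M : SimplexCategoryᵒᵖ ⥤ MonCat.{u}}

/-- The morphisms of `ActionIndex M`. -/
@[ext]
structure Hom (x y : ActionIndex M) : Type u where
  /-- The underlying morphism of the simplex category. -/
  base : x.as ⟶ y.as
  /-- The coefficient in the simplicial monoid. -/
  coeff : M.obj (op x.as)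

instance : Category.{u} (ActionIndex M) where
  Hom := Hom
  id x := ⟨𝟙 _, 1⟩
  comp f g := ⟨f.base ≫ g.base, f.coeff * M.map f.base.op g.coeff⟩
  id_comp f := Hom.ext (Category.id_comp _) (by simp)
  comp_id f := Hom.ext (Category.comp_id _) (by simp)
  assoc f g h := Hom.ext (Category.assoc _ _ _) (by simp [mul_assoc])

@[ext]
lemma hom_ext {x y : ActionIndex M} {f g : x ⟶ y} (h : f.base = g.base)
    (h' : f.coeff = g.coeff) : f = g := Hom.ext h h'

@[simp] lemma id_base (x : ActionIndex M) : Hom.base (𝟙 x) = 𝟙 x.as := rfl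
@[simp] lemma id_coeff (x : ActionIndex M) : Hom.coeff (𝟙 x) = 1 := rfl
@[simp] lemma comp_base {x y z : ActionIndex M} (f : x ⟶ y) (g : y ⟶ z) :
    (f ≫ g).base = f.base ≫ g.base := rfl
@[simp] lemma comp_coeff {x y z : ActionIndex M} (f : x ⟶ y) (g : y ⟶ z) :
    (f ≫ g).coeff = f.coeff * M.map f.base.op g.coeff := rfl

variable (M) in
/-- The inclusion of the simplex category. -/
@[simps]
def incl : SimplexCategory ⥤ ActionIndex M where
  obj k := ⟨k⟩
  map α := ⟨α, 1⟩
  map_id _ := rfl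
  map_comp _ _ := hom_ext rfl (by simp)

/-- The endomorphism given by a simplex of the simplicial monoid. -/
abbrev scalar {x : ActionIndex M} (m : M.obj (op x.as)) : x ⟶ x := ⟨𝟙 _, m⟩

/-- With `comp_scalar`, this is the calculus of a semidirect product: a presheaf amounts to a
simplicial set with compatible left actions of the monoids of simplices. -/
lemma scalar_comp {x y : ActionIndex M} (f : x ⟶ y) :
    scalar f.coeff ≫ (incl M).map f.base = f :=
  hom_ext (Category.id_comp _) (by
    change f.coeff * M.map _ 1 = _
    rw [map_one, mul_one])

lemma comp_scalar {x y : ActionIndex M} (f : x ⟶ y) (m : M.obj (op y.as)) :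
    f ≫ scalar m = scalar (f.coeff * M.map f.base.op m) ≫ (incl M).map f.base :=
  hom_ext ((Category.comp_id _).trans (Category.id_comp _).symm) (by
    change _ = (f.coeff * M.map f.base.op m) * M.map _ 1
    rw [map_one, mul_one]
    rfl)

/-- The generator of the free module on a vertex. -/
def toZero (k : ActionIndex M) : k ⟶ ⟨⦋0⦌⟩ :=
  ⟨SimplexCategory.const _ _ 0, 1⟩

lemma scalar_comp_toZero {k : ActionIndex M} (f : k ⟶ ⟨⦋0⦌⟩) :
    scalar f.coeff ≫ k.toZero = f :=
  hom_ext ((SimplexCategory.eq_const_to_zero _).trans (SimplexCategory.eq_const_to_zero _).symm)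
    (by
      change f.coeff * M.map _ 1 = _
      rw [map_one, mul_one])

lemma incl_map_comp_toZero {j k : SimplexCategory} (α : j ⟶ k) :
    (incl M).map α ≫ toZero ⟨k⟩ = toZero ⟨j⟩ :=
  hom_ext ((SimplexCategory.eq_const_to_zero _).trans (SimplexCategory.eq_const_to_zero _).symm)
    (by
      change 1 * M.map _ 1 = 1
      rw [map_one, mul_one])

end ActionIndex

/-- Simplicial sets with an action of a simplicial monoid. -/
abbrev SModule (M : SimplexCategoryᵒᵖ ⥤ MonCat.{u}) := (ActionIndex M)ᵒᵖ ⥤ Type u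

namespace SModule

open ActionIndex

variable {M : SimplexCategoryᵒᵖ ⥤ MonCat.{u}}

variable (M) in
/-- The underlying simplicial set of a module. -/
abbrev underlying : SModule M ⥤ SSet.{u} := (Functor.whiskeringLeft _ _ _).obj (incl M).op

variable (M) in
/-- The maps of modules that are trivial fibrations of simplicial sets. -/
def trivFib : MorphismProperty (SModule M) :=
  SSet.modelCategoryQuillen.I.rlp.inverseImage (underlying M)

/-- A module is cofibrant if maps out of it lift along trivial fibrations. -/
def Cofibrant (P : SModule M) : Prop :=
  ∀ ⦃Q R : SModule M⦄ (q : Q ⟶ R), trivFib M q → ∀ r : P ⟶ R, ∃ l : P ⟶ Q, l ≫ q = r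

variable (M) in
/-- The generating cofibrations of modules. -/
def genCof : MorphismProperty (SModule M) :=
  .ofHoms (fun n : ℕ => (incl M).op.lan.map ∂Δ[n].ι)

/-- Left Kan extension along `incl M` is the free module functor, so lifting problems transpose to
boundary inclusions of simplicial sets. -/
lemma rlp_genCof : (genCof M).rlp = trivFib M := by
  ext Q R q
  constructor
  · rintro h _ _ _ ⟨n⟩
    exact (((incl M).op.lanAdjunction (Type u)).hasLiftingProperty_iff _ _).1 (h _ ⟨n⟩)
  · rintro h _ _ _ ⟨n⟩
    exact (((incl M).op.lanAdjunction (Type u)).hasLiftingProperty_iff _ _).2 (h _ ⟨n⟩)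

instance : MorphismProperty.IsSmall.{u} (genCof M) :=
  MorphismProperty.isSmall_ofHoms ..

attribute [local instance] Cardinal.fact_isRegular_aleph0 Cardinal.orderBotAleph0OrdToType

instance : MorphismProperty.HasSmallObjectArgument.{u} (genCof M) := by
  refine ⟨.aleph0, inferInstance, inferInstance, ?_⟩
  refine { preservesColimit := ?_ }
  rintro A B X Y _ ⟨n⟩ f hf
  -- Free modules inherit finite presentability because the right adjoint `underlying M` preserves
  -- filtered colimits.
  have : IsFinitelyPresentable.{u} ((incl M).op.lan.obj (∂Δ[n] : SSet.{u})) := by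
    have : (underlying M).IsCardinalAccessible Cardinal.aleph0.{u} :=
      ⟨fun J _ _ => inferInstance⟩
    exact ((incl M).op.lanAdjunction (Type u)).isCardinalPresentable_leftAdjoint_obj _ _
  infer_instance

/-- Small object argument applied to the map from the initial module. -/
lemma exists_cofibrant_replacement (X : SModule M) :
    ∃ (P : SModule M) (p : P ⟶ X), Cofibrant P ∧ trivFib M p := by
  let F := MorphismProperty.factorizationData (genCof M).rlp.llp (genCof M).rlp
    (Limits.initial.to X)
  refine ⟨F.Z, F.p, ?_, rlp_genCof (M := M) ▸ F.hp⟩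
  intro Q R q hq r
  have := F.hi q (rlp_genCof (M := M) ▸ hq)
  have sq : CommSq (Limits.initial.to Q) F.i q r := ⟨Limits.initialIsInitial.hom_ext _ _⟩
  exact ⟨sq.lift, sq.fac_right⟩

end SModule

/-! ### Parametrized families of module maps. -/

namespace SModule

open ActionIndex

variable {M : SimplexCategoryᵒᵖ ⥤ MonCat.{u}}

/-- A family of maps of modules `P ⟶ Q` parametrized by the simplicial set `L`. -/
@[ext]
structure ParamHom (L : SSet.{u}) (P Q : SModule M) where
  /-- The underlying family of functions. -/
  app (k : ActionIndex M) (x : L.obj (op k.as)) (p : P.obj (op k)) : Q.obj (op k)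
  naturality {j k : ActionIndex M} (f : j ⟶ k) (x : L.obj (op k.as)) (p : P.obj (op k)) :
    app j (L.map f.base.op x) (P.map f.op p) = Q.map f.op (app k x p)

namespace ParamHom

variable {L L' : SSet.{u}} {P Q R : SModule M}

/-- Change of parameters. -/
@[simps]
def pullback (i : L' ⟶ L) (u : ParamHom L P Q) : ParamHom L' P Q where
  app k x p := u.app k (i.app _ x) p
  naturality f x p := by
    rw [NatTrans.naturality_apply, u.naturality]

/-- Parametrized composition. -/
@[simps]
def comp (u : ParamHom L P Q) (v : ParamHom L Q R) : ParamHom L P R where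
  app k x p := v.app k x (u.app k x p)
  naturality f x p := by rw [u.naturality, v.naturality]

variable (L) in
/-- The constant family. -/
@[simps]
def const (f : P ⟶ Q) : ParamHom L P Q where
  app k _ p := f.app (op k) p
  naturality g _ p := NatTrans.naturality_apply f g.op p

/-- The map of simplicial sets given by a family of maps `P ⟶ Q` and a simplicial set over `P`. -/
def toHom {X : SSet.{u}} (u : ParamHom L P Q) (b : X ⟶ (underlying M).obj P) :
    X ⊗ L ⟶ (underlying M).obj Q where
  app n := ↾fun x => u.app ⟨n.unop⟩ x.2 (b.app n x.1)
  naturality n m α := by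
    ext x
    exact (congrArg (u.app ⟨m.unop⟩ _) (NatTrans.naturality_apply b α x.1)).trans
      (u.naturality ((incl M).map α.unop) x.2 (b.app n x.1))

/-- The family of maps from a free module corresponding to a map of simplicial sets. -/
def ofFreeHom {k : SimplexCategory} (g : SSet.stdSimplex.obj k ⊗ L ⟶ (underlying M).obj Q) :
    ParamHom L (yoneda.obj (⟨k⟩ : ActionIndex M)) Q where
  app j x f := Q.map (scalar f.coeff).op
    (g.app (op j.as) ⟨SSet.stdSimplex.objEquiv.symm f.base, x⟩)
  naturality {i j} α x f := by
    have h := NatTrans.naturality_apply g α.base.op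
      (⟨SSet.stdSimplex.objEquiv.symm f.base, x⟩ : (SSet.stdSimplex.obj k ⊗ L).obj (op j.as))
    have h' : scalar (α ≫ f).coeff ≫ (incl M).map α.base = α ≫ scalar f.coeff :=
      (comp_scalar α f.coeff).symm
    refine (congrArg (Q.map (scalar (α ≫ f).coeff).op) h).trans ?_
    refine (Functor.map_comp_apply Q _ _ _).symm.trans
      (Eq.trans ?_ (Functor.map_comp_apply Q _ _ _))
    exact congrArg (fun φ : i ⟶ j => Q.map φ.op _) h'

lemma ofFreeHom_app_incl {k : SimplexCategory}
    (g : SSet.stdSimplex.obj k ⊗ L ⟶ (underlying M).obj Q) {j : SimplexCategory}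
    (x : L.obj (op j)) (f : j ⟶ k) :
    (ofFreeHom g).app ⟨j⟩ x ((incl M).map f) =
      g.app (op j) ⟨SSet.stdSimplex.objEquiv.symm f, x⟩ :=
  Functor.map_id_apply Q _ _

/-- By linearity, a family on a free module is determined by its values on simplices with
coefficient `1`. -/
lemma ext_of_free {k : SimplexCategory} {u v : ParamHom L (yoneda.obj (⟨k⟩ : ActionIndex M)) Q}
    (h : ∀ (j : SimplexCategory) (x : L.obj (op j)) (f : j ⟶ k),
      u.app ⟨j⟩ x ((incl M).map f) = v.app ⟨j⟩ x ((incl M).map f)) : u = v := by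
  ext j x f
  have key : ∀ w : ParamHom L (yoneda.obj (⟨k⟩ : ActionIndex M)) Q,
      w.app j x f = Q.map (scalar f.coeff).op (w.app j x ((incl M).map f.base)) := by
    intro w
    refine Eq.trans ?_ (w.naturality (scalar f.coeff) x ((incl M).map f.base))
    exact congrArg₂ (w.app j) (Functor.map_id_apply L _ _).symm (scalar_comp f).symm
  exact (key u).trans ((congrArg _ (h j.as x f.base)).trans (key v).symm)

end ParamHom

/-! ### Cofibrant modules and parametrized lifting -/

section

variable {L : SSet.{u}} (K : L.Subcomplex) {P Q R : SModule M} (q : Q ⟶ R)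
  (u : ParamHom (K : SSet.{u}) P Q) (v : ParamHom L P R)

/-- The simplices of `P` together with a lift of `v` on the free module on this simplex that
extends `u`. -/
@[ext]
structure PartialLift (k : ActionIndex M) where
  /-- The simplex of `P`. -/
  base : P.obj (op k)
  /-- The lift. -/
  lift : ParamHom L (yoneda.obj k) Q
  lift_ι (j : ActionIndex M) (x : (K : SSet.{u}).obj (op j.as)) (f : j ⟶ k) :
    lift.app j x.1 f = u.app j x (P.map f.op base)
  lift_comp (j : ActionIndex M) (x : L.obj (op j.as)) (f : j ⟶ k) :
    q.app _ (lift.app j x f) = v.app j x (P.map f.op base)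

/-- The module of simplices of `P` equipped with a lift. -/
@[simps]
def liftModule : SModule M where
  obj k := PartialLift K q u v k.unop
  map {k k'} f := ↾fun t =>
    { base := P.map f t.base
      lift := (ParamHom.const L (yoneda.map f.unop)).comp t.lift
      lift_ι j x g := (t.lift_ι j x (g ≫ f.unop)).trans
        (congrArg _ (Functor.map_comp_apply P f g.op t.base))
      lift_comp j x g := (t.lift_comp j x (g ≫ f.unop)).trans
        (congrArg _ (Functor.map_comp_apply P f g.op t.base)) }
  map_id k := by
    ext t
    · exact Functor.map_id_apply P _ _
    · rename_i j x g
      exact congrArg (t.lift.app j x) (Category.comp_id (show j ⟶ k.unop from g))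
  map_comp {k k' k''} f g := by
    ext t
    · exact Functor.map_comp_apply P _ _ _
    · rename_i j x h
      exact congrArg (t.lift.app j x)
        (Category.assoc (show j ⟶ k''.unop from h) g.unop f.unop).symm

/-- The projection of the module of simplices equipped with a lift. -/
@[simps]
def liftModuleProj : liftModule K q u v ⟶ P where
  app k := ↾fun t => t.base

/-- The evaluation of the lifts. -/
@[simps]
def evalLift : ParamHom L (liftModule K q u v) Q where
  app k x t := PartialLift.lift t |>.app k x (𝟙 k)
  naturality {j k} f x t := by
    refine Eq.trans ?_ (t.lift.naturality f x (𝟙 k))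
    exact congrArg (t.lift.app j _) ((Category.id_comp f).trans (Category.comp_id f).symm)

variable {K q u v} in
lemma evalLift_ι (j : ActionIndex M) (x : (K : SSet.{u}).obj (op j.as))
    (t : PartialLift K q u v j) :
    (evalLift K q u v).app j x.1 t = u.app j x t.base :=
  (t.lift_ι j x (𝟙 j)).trans (congrArg _ (Functor.map_id_apply P _ _))

variable {K q u v} in
lemma evalLift_comp (j : ActionIndex M) (x : L.obj (op j.as)) (t : PartialLift K q u v j) :
    q.app _ ((evalLift K q u v).app j x t) = v.app j x t.base :=
  (t.lift_comp j x (𝟙 j)).trans (congrArg _ (Functor.map_id_apply P _ _))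

variable {q u v}

/-- A lift of an `m`-simplex of `P` with prescribed boundary is a map `Δ[m] ⊗ L ⟶ Q` over `R`,
prescribed on `∂Δ[m] ⊗ L` by the boundary and on `Δ[m] ⊗ K` by `u`. It exists because the inclusion
of this union is a monomorphism. -/
lemma trivFib_liftModuleProj (hq : trivFib M q)
    (h : ∀ (j : ActionIndex M) (x : (K : SSet.{u}).obj (op j.as)) (p : P.obj (op j)),
      q.app _ (u.app j x p) = v.app j x.1 p) :
    trivFib M (liftModuleProj K q u v) := by
  rintro _ _ _ ⟨m⟩
  have hl := SSet.hasLiftingProperty_of_I_rlp hq (SSet.Subcomplex.unionProd ∂Δ[m] K).ι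
  constructor
  intro a b sq
  let p : P.obj (op ⟨⦋m⦌⟩) := SSet.yonedaEquiv b
  let p' : yoneda.obj (⟨⦋m⦌⟩ : ActionIndex M) ⟶ P := yonedaEquiv.symm p
  have hb : ∀ (j : SimplexCategory) (γ : Δ[m].obj (op j)),
      b.app _ γ = P.map ((incl M).map (SSet.stdSimplex.objEquiv γ)).op p := by
    intro j γ
    obtain ⟨x, hx⟩ := SSet.yonedaEquiv.symm.surjective b
    subst hx
    have : p = x := SSet.yonedaEquiv.apply_symm_apply x
    rw [this]
    rfl
  have ha : ∀ (j : SimplexCategory) (γ : (∂Δ[m] : SSet.{u}).obj (op j)),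
      PartialLift.base (a.app _ γ) = b.app _ γ.1 := fun j γ => by
    have := ConcreteCategory.congr_hom (congr_app sq.w (op j)) γ
    exact this
  -- The two prescriptions agree on `∂Δ[m] ⊗ K` since partial lifts extend `u`.
  let c := (SSet.Subcomplex.unionProd.isPushout ∂Δ[m] K).desc
    (u.toHom b) ((evalLift K q u v).toHom a) (by
      ext n x
      refine Eq.trans ?_ (evalLift_ι ⟨n.unop⟩ x.2 (a.app n x.1)).symm
      exact congrArg _ (ha n.unop x.1).symm)
  have sq' : CommSq c (SSet.Subcomplex.unionProd ∂Δ[m] K).ι ((underlying M).map q)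
      (v.toHom b) := by
    constructor
    apply (SSet.Subcomplex.unionProd.isPushout ∂Δ[m] K).hom_ext
    · rw [IsPushout.inl_desc_assoc]
      ext n x
      exact h ⟨n.unop⟩ x.2 (b.app n x.1)
    · rw [IsPushout.inr_desc_assoc]
      ext n x
      refine (evalLift_comp ⟨n.unop⟩ x.2 (a.app n x.1)).trans ?_
      exact congrArg _ (ha n.unop x.1)
  have hd₁ : ∀ (j : SimplexCategory) (γ : Δ[m].obj (op j)) (x : (K : SSet.{u}).obj (op j)),
      sq'.lift.app _ ⟨γ, x.1⟩ = u.app ⟨j⟩ x (b.app _ γ) := by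
    have h₁ : (Δ[m] ◁ K.ι) ≫ sq'.lift = u.toHom b := by
      rw [← SSet.Subcomplex.unionProd.ι₁_ι, Category.assoc, sq'.fac_left, IsPushout.inl_desc]
    intro j γ x
    have := ConcreteCategory.congr_hom (congr_app h₁ (op j)) ⟨γ, x⟩
    exact this
  have hd₂ : ∀ (j : SimplexCategory) (γ : (∂Δ[m] : SSet.{u}).obj (op j)) (x : L.obj (op j)),
      sq'.lift.app _ ⟨γ.1, x⟩ = (evalLift K q u v).app ⟨j⟩ x (a.app _ γ) := by
    have h₂ : (∂Δ[m].ι ▷ L) ≫ sq'.lift = (evalLift K q u v).toHom a := by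
      rw [← SSet.Subcomplex.unionProd.ι₂_ι, Category.assoc, sq'.fac_left, IsPushout.inr_desc]
    intro j γ x
    have := ConcreteCategory.congr_hom (congr_app h₂ (op j)) ⟨γ, x⟩
    exact this
  -- The simplicial lift is extended linearly to the free module; the two conditions on a partial
  -- lift then need checking only on coefficient `1`.
  have ht₁ : (ParamHom.ofFreeHom sq'.lift).pullback K.ι = (ParamHom.const _ p').comp u := by
    apply ParamHom.ext_of_free
    intro j x f
    refine (ParamHom.ofFreeHom_app_incl sq'.lift x.1 f).trans ((hd₁ _ _ _).trans ?_)
    exact congrArg _ (hb _ _)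
  have ht₂ : (ParamHom.ofFreeHom sq'.lift).comp (ParamHom.const _ q) =
      (ParamHom.const _ p').comp v := by
    apply ParamHom.ext_of_free
    intro j x f
    refine (congrArg (q.app _) (ParamHom.ofFreeHom_app_incl sq'.lift x f)).trans ?_
    refine (ConcreteCategory.congr_hom (congr_app sq'.fac_right (op j))
      ⟨SSet.stdSimplex.objEquiv.symm f, x⟩).trans ?_
    exact congrArg _ (hb _ _)
  let t : PartialLift K q u v ⟨⦋m⦌⟩ :=
    { base := p
      lift := .ofFreeHom sq'.lift
      lift_ι j x f := congr_fun (congr_fun (congr_fun (congrArg ParamHom.app ht₁) j) x) f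
      lift_comp j x f := congr_fun (congr_fun (congr_fun (congrArg ParamHom.app ht₂) j) x) f }
  refine ⟨⟨⟨SSet.yonedaEquiv.symm t, ?_, ?_⟩⟩⟩
  · ext n γ
    refine PartialLift.ext ((hb n.unop γ.1).symm.trans (ha _ _).symm) ?_
    apply ParamHom.ext_of_free
    intro j x f
    refine (congrArg ((ParamHom.ofFreeHom sq'.lift).app ⟨j⟩ x)
      ((incl M).map_comp f (SSet.stdSimplex.objEquiv γ.1)).symm).trans ?_
    refine (ParamHom.ofFreeHom_app_incl sq'.lift x (f ≫ SSet.stdSimplex.objEquiv γ.1)).trans ?_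
    refine (hd₂ j ((∂Δ[m] : SSet.{u}).map f.op γ) x).trans ?_
    refine (congrArg _ (NatTrans.naturality_apply a f.op γ)).trans ?_
    exact congrArg ((a.app n γ).lift.app ⟨j⟩ x) (Category.id_comp ((incl M).map f))
  · ext n γ
    exact (hb n.unop γ).symm

/-- A section of the module of partial lifts, followed by evaluation, is a global lift; cofibrancy
of `P` supplies the section. -/
lemma Cofibrant.exists_lift (hP : Cofibrant P) (hq : trivFib M q)
    (h : ∀ (j : ActionIndex M) (x : (K : SSet.{u}).obj (op j.as)) (p : P.obj (op j)),
      q.app _ (u.app j x p) = v.app j x.1 p) :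
    ∃ w : ParamHom L P Q, w.pullback K.ι = u ∧ w.comp (.const _ q) = v := by
  obtain ⟨s, hs⟩ := hP (liftModuleProj K q u v) (trivFib_liftModuleProj K hq h) (𝟙 P)
  have hs' : ∀ (k : ActionIndex M) (p : P.obj (op k)), PartialLift.base (s.app _ p) = p :=
    fun k p => by
      have := ConcreteCategory.congr_hom (congr_app hs (op k)) p
      exact this
  refine ⟨(ParamHom.const _ s).comp (evalLift K q u v), ?_, ?_⟩
  · ext k x p
    exact (evalLift_ι k x (s.app _ p)).trans (congrArg _ (hs' k p))
  · ext k x p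
    exact (evalLift_comp k x (s.app _ p)).trans (congrArg _ (hs' k p))

end

end SModule

/-! ### Simplicial monoids as presheaves of monoids. -/

namespace SMon

/-- The monoid of `n`-simplices of a simplicial monoid. -/
abbrev monoidObj (N : Mon SSet.{u}) (n : SimplexCategoryᵒᵖ) : Monoid (N.X.obj n) where
  mul s t := (MonObj.mul (X := N.X)).app n ((⟨s, t⟩ : (N.X ⊗ N.X).obj n))
  one := (MonObj.one (X := N.X)).app n PUnit.unit
  one_mul s := ConcreteCategory.congr_hom (congr_app (MonObj.one_mul N.X) n)
    ((⟨PUnit.unit, s⟩ : (𝟙_ SSet.{u} ⊗ N.X).obj n))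
  mul_one s := ConcreteCategory.congr_hom (congr_app (MonObj.mul_one N.X) n)
    ((⟨s, PUnit.unit⟩ : (N.X ⊗ 𝟙_ SSet.{u}).obj n))
  mul_assoc s t r := ConcreteCategory.congr_hom (congr_app (MonObj.mul_assoc N.X) n)
    ((⟨⟨s, t⟩, r⟩ : ((N.X ⊗ N.X) ⊗ N.X).obj n))

/-- A simplicial monoid, as a presheaf of monoids. -/
def toPresheaf (N : Mon SSet.{u}) : SimplexCategoryᵒᵖ ⥤ MonCat.{u} where
  obj n := @MonCat.of (N.X.obj n) (monoidObj N n)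
  map {n m} α := @MonCat.ofHom _ _ (monoidObj N n) (monoidObj N m)
    (letI := monoidObj N n; letI := monoidObj N m
    { toFun := N.X.map α
      map_one' := (NatTrans.naturality_apply (MonObj.one (X := N.X)) α PUnit.unit).symm
      map_mul' s t := (NatTrans.naturality_apply (MonObj.mul (X := N.X)) α
        (⟨s, t⟩ : (N.X ⊗ N.X).obj n)).symm })
  map_id n := MonCat.hom_ext (DFunLike.ext _ _ (Functor.map_id_apply N.X n))
  map_comp α β := MonCat.hom_ext (DFunLike.ext _ _ (Functor.map_comp_apply N.X α β))

end SMon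

/-! ### The modules `A(a, x)` and the category of maps between their resolutions. -/

namespace SCat

variable (A : SCat.{u})

/-- The identity of `x`, as an `n`-simplex of `A(x, x)`. -/
def idSimplex (x : A) (n : SimplexCategoryᵒᵖ) : (A.hom x x).obj n :=
  (eId SSet.{u} x).app n PUnit.unit

lemma map_idSimplex (x : A) {m n : SimplexCategoryᵒᵖ} (α : m ⟶ n) :
    (A.hom x x).map α (A.idSimplex x m) = A.idSimplex x n :=
  (NatTrans.naturality_apply (eId SSet.{u} x) α PUnit.unit).symm

lemma idSimplex_comp {x y : A} {n : SimplexCategoryᵒᵖ} (f : (A.hom x y).obj n) :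
    A.compSimplex (A.idSimplex x n) f = f :=
  ConcreteCategory.congr_hom (congr_app (e_id_comp SSet.{u} x y) n) f

lemma comp_idSimplex {x y : A} {n : SimplexCategoryᵒᵖ} (f : (A.hom x y).obj n) :
    A.compSimplex f (A.idSimplex y n) = f :=
  ConcreteCategory.congr_hom (congr_app (e_comp_id SSet.{u} x y) n) f

variable {A} {a : A} {N : Mon SSet.{u}} (π : N ⟶ A.endMon a)

lemma hom_app_mul {n : SimplexCategoryᵒᵖ} (s t : (SMon.toPresheaf N).obj n) :
    π.hom.app n (s * t) = A.compSimplex (π.hom.app n s) (π.hom.app n t) :=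
  ConcreteCategory.congr_hom (congr_app (IsMonHom.mul_hom π.hom) n) (⟨s, t⟩ : (N.X ⊗ N.X).obj n)

lemma hom_app_one (n : SimplexCategoryᵒᵖ) :
    π.hom.app n (1 : (SMon.toPresheaf N).obj n) = A.idSimplex a n :=
  ConcreteCategory.congr_hom (congr_app (IsMonHom.one_hom π.hom) n) PUnit.unit

/-- The simplicial set `A(a, x)`, with the action of a simplicial monoid over `A(a, a)`. -/
def homModule (x : A) : SModule (SMon.toPresheaf N) where
  obj k := (A.hom a x).obj (op k.unop.as)
  map f := ↾fun s => A.compSimplex (π.hom.app _ f.unop.coeff) ((A.hom a x).map f.unop.base.op s)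
  map_id k := by
    ext s
    refine (congrArg₂ A.compSimplex (hom_app_one π _) (Functor.map_id_apply (A.hom a x) _ s)).trans ?_
    exact A.idSimplex_comp s
  map_comp {k l m} f g := by
    ext s
    have h₁ := hom_app_mul π g.unop.coeff ((SMon.toPresheaf N).map g.unop.base.op f.unop.coeff)
    have h₂ : π.hom.app _ ((SMon.toPresheaf N).map g.unop.base.op f.unop.coeff) =
      (A.hom a a).map g.unop.base.op (π.hom.app _ f.unop.coeff) :=
      NatTrans.naturality_apply π.hom g.unop.base.op f.unop.coeff
    refine (congrArg₂ A.compSimplex (h₁.trans (congrArg _ h₂))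
      (Functor.map_comp_apply (A.hom a x) f.unop.base.op g.unop.base.op s)).trans ?_
    refine (A.compSimplex_assoc _ _ _).trans (congrArg _ ?_)
    exact (A.map_compSimplex _ _ _).symm

/-- The postcomposition with a family of morphisms of `A`. -/
def postcomp {L : SSet.{u}} {x y : A} (b : L ⟶ A.hom x y) :
    SModule.ParamHom L (homModule π x) (homModule π y) where
  app k l s := A.compSimplex s (b.app _ l)
  naturality {j k} f l s := by
    refine (congrArg _ (NatTrans.naturality_apply b f.base.op l)).trans ?_
    refine (A.compSimplex_assoc _ _ _).trans (congrArg _ ?_)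
    exact (A.map_compSimplex _ _ _).symm

/-! ### The simplicial category of families of maps between resolutions -/

variable (P : A → SModule (SMon.toPresheaf N)) (p : ∀ x, P x ⟶ homModule π x)

/-- The `n`-simplices of the simplicial set of maps between resolutions of modules `A(a, x)` and
`A(a, y)` that lie over the postcomposition with a simplex of `A(x, y)`. -/
@[ext]
structure ResolvedSimplex (x y : A) (n : SimplexCategoryᵒᵖ) where
  /-- The underlying simplex of `A(x, y)`. -/
  base : (A.hom x y).obj n
  /-- The family of maps between the resolutions. -/
  family : SModule.ParamHom (SSet.stdSimplex.obj n.unop) (P x) (P y)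
  comm (k : ActionIndex (SMon.toPresheaf N)) (l : (SSet.stdSimplex.obj n.unop).obj (op k.as))
    (u : (P x).obj (op k)) :
    (p y).app _ (family.app k l u) = A.compSimplex ((p x).app _ u)
      ((A.hom x y).map (SSet.stdSimplex.objEquiv l).op base)

/-- The simplicial sets of maps between resolutions. -/
def resolvedHom (x y : A) : SSet.{u} where
  obj n := ResolvedSimplex π P p x y n
  map {n m} α := ↾fun t =>
    { base := (A.hom x y).map α t.base
      family := t.family.pullback (SSet.stdSimplex.map α.unop)
      comm k l u := (t.comm k _ u).trans (congrArg _
        (Functor.map_comp_apply (A.hom x y) α (SSet.stdSimplex.objEquiv l).op t.base)) }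
  map_id n := by
    ext t
    · exact Functor.map_id_apply _ _ _
    · rename_i k l u
      exact congrArg (fun l' => t.family.app k l' u)
        (ConcreteCategory.congr_hom (congr_app (SSet.stdSimplex.map_id n.unop) (op k.as)) l)
  map_comp {n m r} α β := by
    ext t
    · exact Functor.map_comp_apply _ _ _ _
    · rename_i k l u
      exact congrArg (fun l' => t.family.app k l' u)
        (ConcreteCategory.congr_hom (congr_app (SSet.stdSimplex.map_comp β.unop α.unop)
          (op k.as)) l)

/-- The projection to the simplicial sets of morphisms of `A`. -/
def resolvedProj (x y : A) : resolvedHom π P p x y ⟶ A.hom x y where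
  app n := ↾fun t => t.base

/-- The simplicial category of families of maps between resolutions. -/
def resolved : SCat.{u} where
  Obj := A
  enriched :=
    { Hom := resolvedHom π P p
      id x :=
        { app n := ↾fun _ =>
            { base := A.idSimplex x n
              family := .const _ (𝟙 _)
              comm k l u := (A.comp_idSimplex _).symm.trans
                (congrArg _ (A.map_idSimplex _ _).symm) }
          naturality n m α := by
            ext t
            exact ResolvedSimplex.ext (A.map_idSimplex x α).symm rfl }
      comp x y z :=
        { app n := ↾fun t =>
            { base := A.compSimplex t.1.base t.2.base
              family := t.1.family.comp t.2.family
              comm k l u := by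
                refine (t.2.comm k l _).trans ?_
                refine (congrArg (fun s => A.compSimplex s _) (t.1.comm k l u)).trans ?_
                refine (A.compSimplex_assoc _ _ _).trans (congrArg _ ?_)
                exact (A.map_compSimplex _ _ _).symm }
          naturality n m α := by
            ext t
            exact ResolvedSimplex.ext (A.map_compSimplex α _ _).symm rfl }
      id_comp x y := by
        ext n t
        exact ResolvedSimplex.ext (A.idSimplex_comp t.base) rfl
      comp_id x y := by
        ext n t
        exact ResolvedSimplex.ext (A.comp_idSimplex t.base) rfl
      assoc w x y z := by
        ext n t
        exact ResolvedSimplex.ext (A.compSimplex_assoc t.1.base t.2.1.base t.2.2.base) rfl }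

/-- The projection of the simplicial category of families of maps between resolutions. -/
def resolvedFunctor : resolved π P p ⟶ A where
  obj x := x
  map x y := resolvedProj π P p x y
  map_id _ := rfl
  map_comp _ _ _ := rfl

end SCat

/-! ### The projection from maps between resolutions is a trivial fibration. -/

namespace SCat

variable {A : SCat.{u}} {a : A} {N : Mon SSet.{u}} (π : N ⟶ A.endMon a)
  (P : A → SModule (SMon.toPresheaf N)) (p : ∀ x, P x ⟶ homModule π x)

/-- The family of maps given by a map to the simplicial set of maps between resolutions. -/
def familyOfHom {L : SSet.{u}} {x y : A} (b : L ⟶ resolvedHom π P p x y) :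
    SModule.ParamHom L (P x) (P y) where
  app k l u := (ResolvedSimplex.family (b.app _ l)).app k (SSet.stdSimplex.objEquiv.symm (𝟙 _)) u
  naturality {j k} f l u := by
    have h : b.app _ (L.map f.base.op l) = (resolvedHom π P p x y).map f.base.op (b.app _ l) :=
      NatTrans.naturality_apply b f.base.op l
    refine (congrArg (fun t => (ResolvedSimplex.family t).app j
      (SSet.stdSimplex.objEquiv.symm (𝟙 _)) _) h).trans ?_
    refine Eq.trans ?_ ((ResolvedSimplex.family (b.app _ l)).naturality f _ u)
    refine congrArg (fun l' => (ResolvedSimplex.family (b.app _ l)).app j l' _) ?_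
    exact SSet.stdSimplex.objEquiv.injective
      ((Category.id_comp f.base).trans (Category.comp_id f.base).symm)

/-- `familyOfHom` keeps only values at top simplices of the parameter; naturality of `b` recovers
all the others. -/
lemma familyOfHom_app_map {L : SSet.{u}} {x y : A} (b : L ⟶ resolvedHom π P p x y)
    {n : SimplexCategoryᵒᵖ} (t : L.obj n) (k : ActionIndex (SMon.toPresheaf N))
    (l : (SSet.stdSimplex.obj n.unop).obj (op k.as)) (u : (P x).obj (op k)) :
    (familyOfHom π P p b).app k (L.map (SSet.stdSimplex.objEquiv l).op t) u =
      (ResolvedSimplex.family (b.app n t)).app k l u := by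
  have h := NatTrans.naturality_apply b (SSet.stdSimplex.objEquiv l).op t
  refine (congrArg (fun t => (ResolvedSimplex.family t).app k
      (SSet.stdSimplex.objEquiv.symm (𝟙 _)) _) h).trans ?_
  refine congrArg (fun l' => (ResolvedSimplex.family (b.app _ t)).app k l' _) ?_
  exact SSet.stdSimplex.objEquiv.injective (Category.id_comp (SSet.stdSimplex.objEquiv l))

variable {P p}

/-- A lifting problem against `∂Δ[m] ⟶ Δ[m]` asks to extend a family of maps from `∂Δ[m]` to `Δ[m]`
over a given postcomposition: this is parametrized lifting. -/
lemma I_rlp_resolvedProj {x y : A} (hx : SModule.Cofibrant (P x))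
    (hy : SModule.trivFib _ (p y)) :
    SSet.modelCategoryQuillen.I.rlp (resolvedProj π P p x y) := by
  rintro _ _ _ ⟨m⟩
  constructor
  intro c b sq
  have hc : ∀ (j : SimplexCategory) (γ : (∂Δ[m] : SSet.{u}).obj (op j)),
      ResolvedSimplex.base (c.app _ γ) = b.app _ γ.1 := fun j γ => by
    have := ConcreteCategory.congr_hom (congr_app sq.w (op j)) γ
    exact this
  obtain ⟨s, rfl⟩ := SSet.yonedaEquiv.symm.surjective b
  obtain ⟨w, hw₁, hw₂⟩ := hx.exists_lift ∂Δ[m] (q := p y) hy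
    (u := familyOfHom π P p c)
    (v := (SModule.ParamHom.const _ (p x)).comp (postcomp π (SSet.yonedaEquiv.symm s))) (by
      intro j γ u
      refine ((ResolvedSimplex.comm (c.app _ γ) j _ u)).trans ?_
      refine congrArg _ (Eq.trans ?_ (hc _ _))
      exact Functor.map_id_apply (A.hom x y) _ _)
  let t : ResolvedSimplex π P p x y (op ⦋m⦌) :=
    { base := s
      family := w
      comm k l u := congr_fun (congr_fun (congr_fun (congrArg SModule.ParamHom.app hw₂) k) l) u }
  refine ⟨⟨⟨SSet.yonedaEquiv.symm t, ?_, ?_⟩⟩⟩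
  · ext n γ
    refine ResolvedSimplex.ext (hc n.unop γ).symm ?_
    ext k l u
    refine Eq.trans ?_ (familyOfHom_app_map π P p c γ k l u)
    rw [← hw₁]
    rfl
  · ext n γ
    rfl

lemma trivialFibrations_resolvedFunctor (hP : ∀ x, SModule.Cofibrant (P x))
    (hp : ∀ x, SModule.trivFib _ (p x)) : trivialFibrations SCat.{u} (resolvedFunctor π P p) :=
  trivialFibrations_of_locally (fun x y => I_rlp_resolvedProj π (hP x) (hp y)) (fun x => ⟨x, rfl⟩)

/-! ### Endomorphism monoids -/

/-- The action of a simplicial functor on endomorphism monoids. -/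
@[simps]
def endMap {A B : SCat.{u}} (F : A ⟶ B) (x : A) : A.endMon x ⟶ B.endMon (onObj F x) where
  hom := onHom F x x
  isMonHom_hom :=
    { one_hom := EnrichedFunctor.map_id F x
      mul_hom := EnrichedFunctor.map_comp F x x x }

lemma endMap_comp {A B C : SCat.{u}} (F : A ⟶ B) (G : B ⟶ C) (x : A) :
    endMap (F ≫ G) x = endMap F x ≫ endMap G (onObj F x) := rfl

lemma endMap_comp_eqToHom {A : SCat.{u}} {F : A ⟶ A} (hF : F = 𝟙 A) (x : A)
    (h : A.endMon (onObj F x) = A.endMon x) : endMap F x ≫ eqToHom h = 𝟙 _ := by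
  subst hF
  rfl

lemma eqToHom_comp_endMap {A B : SCat.{u}} (F : A ⟶ B) {x y : A} (h : x = y) :
    eqToHom (congrArg A.endMon h) ≫ endMap F y =
      endMap F x ≫ eqToHom (congrArg (fun z => B.endMon (onObj F z)) h) := by
  subst h
  simp

/-- Injectivity of `F` on objects forces `G` to send `F b` back to `b`, but only up to a
propositional equality, hence the transport. -/
lemma exists_section_endMap {A B : SCat.{u}} {G : A ⟶ B} {F : B ⟶ A} (h : G ≫ F = 𝟙 A)
    (hF : Function.Injective (onObj F)) (b : B) :
    ∃ g : A.endMon (onObj F b) ⟶ B.endMon b, g ≫ endMap F b = 𝟙 _ := by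
  have hb : onObj G (onObj F b) = b :=
    hF (congrArg (fun H : A ⟶ A => onObj H (onObj F b)) h)
  refine ⟨endMap G _ ≫ eqToHom (congrArg B.endMon hb), ?_⟩
  rw [Category.assoc, eqToHom_comp_endMap F hb, ← Category.assoc, ← endMap_comp]
  exact endMap_comp_eqToHom h _ _

/-- The resolution of `A(a, a)` by the free module on a vertex. -/
def freeResolution : yoneda.obj (⟨⦋0⦌⟩ : ActionIndex (SMon.toPresheaf N)) ⟶ homModule π a :=
  yonedaEquiv.symm (A.idSimplex a (op ⦋0⦌))

lemma freeResolution_app {k : ActionIndex (SMon.toPresheaf N)}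
    (f : k ⟶ (⟨⦋0⦌⟩ : ActionIndex (SMon.toPresheaf N))) :
    (freeResolution π).app (op k) f = π.hom.app _ f.coeff :=
  (congrArg _ (A.map_idSimplex a f.base.op)).trans (A.comp_idSimplex _)

/-- Maps out of the free module on a vertex are vertices, and vertices lift along trivial
fibrations. -/
lemma cofibrant_yoneda {M : SimplexCategoryᵒᵖ ⥤ MonCat.{u}} :
    SModule.Cofibrant (yoneda.obj (⟨⦋0⦌⟩ : ActionIndex M)) := by
  intro Q R q hq r
  obtain ⟨s, hs⟩ := SSet.exists_vertex_of_I_rlp hq (yonedaEquiv r)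
  refine ⟨yonedaEquiv.symm s, yonedaEquiv.injective ?_⟩
  refine (yonedaEquiv_comp _ _).trans (Eq.trans ?_ hs)
  exact congrArg (q.app _) (yonedaEquiv.apply_symm_apply _)

/-- The simplicial set underlying the free module on a vertex is the simplicial monoid. -/
def underlyingFreeIso (N : Mon SSet.{u}) : (SModule.underlying (SMon.toPresheaf N)).obj
    (yoneda.obj (⟨⦋0⦌⟩ : ActionIndex (SMon.toPresheaf N))) ≅ N.X :=
  NatIso.ofComponents (fun n => Equiv.toIso
    { toFun f := ActionIndex.Hom.coeff f
      invFun m := ⟨SimplexCategory.const _ _ 0, m⟩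
      left_inv f := ActionIndex.hom_ext (SimplexCategory.eq_const_to_zero _).symm rfl
      right_inv _ := rfl }) (fun {n m} α => by
    ext f
    exact one_mul ((SMon.toPresheaf N).map α (ActionIndex.Hom.coeff f)))

/-- The simplicial set underlying the module `A(a, x)`. -/
def underlyingHomModuleIso (x : A) :
    (SModule.underlying _).obj (homModule π x) ≅ A.hom a x :=
  NatIso.ofComponents (fun n => Iso.refl _) (fun {n m} α => by
    ext s
    exact (congrArg (fun i => A.compSimplex i _) (hom_app_one π m)).trans (A.idSimplex_comp _))

/-- On underlying simplicial sets this augmentation is `π` itself, up to isomorphism. -/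
lemma trivFib_freeResolution (hπ : SSet.modelCategoryQuillen.I.rlp π.hom) :
    SModule.trivFib _ (freeResolution π) := by
  have h : (SModule.underlying _).map (freeResolution π) = (underlyingFreeIso N).hom ≫ π.hom ≫
      (underlyingHomModuleIso π a).inv := by
    ext n f
    exact freeResolution_app π f
  change SSet.modelCategoryQuillen.I.rlp ((SModule.underlying _).map (freeResolution π))
  have h' : SSet.modelCategoryQuillen.I.rlp (underlyingHomModuleIso π a).inv :=
    MorphismProperty.rlp_of_isIso _ _
  rw [h]
  exact MorphismProperty.comp_mem _ _ _ (MorphismProperty.rlp_of_isIso _ _)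
    (MorphismProperty.comp_mem _ _ _ hπ h')

end SCat

/-! ### Endomorphisms of the free module on a vertex. -/

namespace SModule.ParamHom

open ActionIndex

variable {M : SimplexCategoryᵒᵖ ⥤ MonCat.{u}} {L : SSet.{u}}

/-- The coefficients of a family of endomorphisms of the free module on a vertex. -/
def coeff (u : ParamHom L (yoneda.obj (⟨⦋0⦌⟩ : ActionIndex M)) (yoneda.obj ⟨⦋0⦌⟩))
    (n : SimplexCategoryᵒᵖ) (l : L.obj n) : M.obj n :=
  Hom.coeff (u.app ⟨n.unop⟩ l (toZero _))

/-- Left linearity makes every endomorphism a right multiplication by its value on the generator. -/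
lemma coeff_app (u : ParamHom L (yoneda.obj (⟨⦋0⦌⟩ : ActionIndex M)) (yoneda.obj ⟨⦋0⦌⟩))
    {n : SimplexCategoryᵒᵖ} (l : L.obj n) (f : (⟨n.unop⟩ : ActionIndex M) ⟶ ⟨⦋0⦌⟩) :
    Hom.coeff (u.app ⟨n.unop⟩ l f) = f.coeff * u.coeff n l := by
  have h := u.naturality (scalar f.coeff : (⟨n.unop⟩ : ActionIndex M) ⟶ ⟨n.unop⟩) l (toZero _)
  have h₁ : u.app ⟨n.unop⟩ l f = u.app ⟨n.unop⟩ (L.map (𝟙 n) l)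
      (scalar f.coeff ≫ toZero (⟨n.unop⟩ : ActionIndex M)) :=
    congrArg₂ (u.app _) (Functor.map_id_apply L _ _).symm (scalar_comp_toZero f).symm
  refine (congrArg Hom.coeff (h₁.trans h)).trans ?_
  exact congrArg (f.coeff * ·) (Functor.map_id_apply (M ⋙ CategoryTheory.forget _) n (u.coeff n l))

lemma coeff_map (u : ParamHom L (yoneda.obj (⟨⦋0⦌⟩ : ActionIndex M)) (yoneda.obj ⟨⦋0⦌⟩))
    {n m : SimplexCategoryᵒᵖ} (α : n ⟶ m) (l : L.obj n) :
    u.coeff m (L.map α l) = M.map α (u.coeff n l) := by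
  have h := u.naturality ((incl M).map α.unop) l (toZero ⟨n.unop⟩)
  have h₁ := congrArg (u.app ⟨m.unop⟩ (L.map α l)) (incl_map_comp_toZero (M := M) α.unop)
  refine (congrArg Hom.coeff (h₁.symm.trans h)).trans ?_
  exact one_mul (M.map α (u.coeff n l))

end SModule.ParamHom

/-! ### From endomorphisms of a free resolution back to the monoid. -/

namespace SCat

variable {A : SCat.{u}} {a : A} {N : Mon SSet.{u}} (π : N ⟶ A.endMon a)
  {P : A → SModule (SMon.toPresheaf N)} {p : ∀ x, P x ⟶ homModule π x}
  (e : P a ≅ yoneda.obj (⟨⦋0⦌⟩ : ActionIndex (SMon.toPresheaf N)))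

/-- The family of endomorphisms of the free module given by a simplex of endomorphisms of a
resolution that is free. -/
abbrev freeFamily {n : SimplexCategoryᵒᵖ} (t : ResolvedSimplex π P p a a n) :
    SModule.ParamHom (SSet.stdSimplex.obj n.unop)
      (yoneda.obj (⟨⦋0⦌⟩ : ActionIndex (SMon.toPresheaf N))) (yoneda.obj ⟨⦋0⦌⟩) :=
  ((SModule.ParamHom.const _ e.inv).comp t.family).comp (.const _ e.hom)

/-- The endomorphisms of a free resolution are given by simplices of the simplicial monoid. -/
def resolvedEndHom : (resolved π P p).endMon a ⟶ N where
  hom :=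
    { app n := ↾fun t => (freeFamily π e t).coeff n (SSet.stdSimplex.objEquiv.symm (𝟙 _))
      naturality n m α := by
        ext t
        refine Eq.trans ?_ ((freeFamily π e t).coeff_map α (SSet.stdSimplex.objEquiv.symm (𝟙 _)))
        refine congrArg ((freeFamily π e t).coeff m) ?_
        exact SSet.stdSimplex.objEquiv.injective
          ((Category.id_comp α.unop).trans (Category.comp_id α.unop).symm) }
  isMonHom_hom :=
    { one_hom := by
        ext n t
        have := ConcreteCategory.congr_hom (congr_app e.inv_hom_id (op ⟨n.unop⟩))
          (ActionIndex.toZero (M := SMon.toPresheaf N) ⟨n.unop⟩)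
        exact congrArg ActionIndex.Hom.coeff this
      mul_hom := by
        ext n t
        -- Right multiplications compose in diagrammatic order, so no opposite monoid appears.
        have h := (freeFamily π e t.2).coeff_app (SSet.stdSimplex.objEquiv.symm (𝟙 _))
          ((freeFamily π e t.1).app ⟨n.unop⟩ (SSet.stdSimplex.objEquiv.symm (𝟙 _))
            (ActionIndex.toZero _))
        refine Eq.trans ?_ h
        have := ConcreteCategory.congr_hom (congr_app e.hom_inv_id (op ⟨n.unop⟩))
          (t.1.family.app ⟨n.unop⟩ (SSet.stdSimplex.objEquiv.symm (𝟙 _))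
            (e.inv.app _ (ActionIndex.toZero _)))
        exact congrArg (fun y => ActionIndex.Hom.coeff (e.hom.app _ (t.2.family.app ⟨n.unop⟩
          (SSet.stdSimplex.objEquiv.symm (𝟙 _)) y))) this.symm }

/-- Evaluate the compatibility `comm` at the generator, whose image in `A(a, a)` is the identity. -/
lemma resolvedEndHom_comp (he : e.inv ≫ p a = freeResolution π) :
    resolvedEndHom π e ≫ π = endMap (resolvedFunctor π P p) a := by
  ext n t
  let k : ActionIndex (SMon.toPresheaf N) := ⟨n.unop⟩
  let l : (SSet.stdSimplex.obj n.unop).obj (op k.as) := SSet.stdSimplex.objEquiv.symm (𝟙 _)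
  let y := t.family.app k l (e.inv.app _ k.toZero)
  have he' : ∀ z, (p a).app (op k) (e.inv.app _ z) = (freeResolution π).app _ z := fun z => by
    rw [← he]
    rfl
  have h₁ := freeResolution_app π ((freeFamily π e t).app k l k.toZero)
  have h₂ : e.inv.app _ (e.hom.app _ y) = y :=
    ConcreteCategory.congr_hom (congr_app e.hom_inv_id (op k)) y
  refine h₁.symm.trans ((he' _).symm.trans ((congrArg _ h₂).trans ((t.comm k l _).trans ?_)))
  refine (congrArg₂ A.compSimplex ((he' _).trans ((freeResolution_app π k.toZero).trans
    (hom_app_one π _))) (Functor.map_id_apply (A.hom a a) n t.base)).trans ?_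
  exact A.idSimplex_comp _

variable (a) in
/-- A cofibrant resolution of the module `A(a, x)`. -/
structure Resolution (x : A) where
  /-- The resolution. -/
  obj : SModule (SMon.toPresheaf N)
  /-- The augmentation. -/
  hom : obj ⟶ homModule π x
  cofibrant : obj.Cofibrant
  trivFib : SModule.trivFib _ hom

instance (x : A) : Nonempty (Resolution a π x) := by
  obtain ⟨P, p, hP, hp⟩ := SModule.exists_cofibrant_replacement (homModule π x)
  exact ⟨⟨P, p, hP, hp⟩⟩

lemma Resolution.exists_iso {x : A} {r s : Resolution a π x} (h : r = s) :
    ∃ e : r.obj ≅ s.obj, e.inv ≫ r.hom = s.hom := by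
  subst h
  exact ⟨Iso.refl _, Category.id_comp _⟩

variable (a) in
lemma exists_free_resolutions (hπ : SSet.modelCategoryQuillen.I.rlp π.hom) :
    ∃ (P : A → SModule (SMon.toPresheaf N)) (p : ∀ x, P x ⟶ homModule π x)
      (e : P a ≅ yoneda.obj (⟨⦋0⦌⟩ : ActionIndex (SMon.toPresheaf N))),
      (∀ x, (P x).Cofibrant) ∧ (∀ x, SModule.trivFib _ (p x)) ∧
        e.inv ≫ p a = freeResolution π := by
  classical
  let r₀ : Resolution a π a := ⟨_, _, cofibrant_yoneda, trivFib_freeResolution π hπ⟩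
  -- Only the resolution at `a` has to be free. The updated choice is merely propositionally equal
  -- to `r₀` at `a`, so freeness is recorded by an isomorphism.
  let r : ∀ x, Resolution a π x := Function.update (fun x => Classical.arbitrary _) a r₀
  obtain ⟨e, he⟩ := Resolution.exists_iso π
    (show r a = r₀ from Function.update_self a r₀ fun x => Classical.arbitrary _)
  exact ⟨fun x => (r x).obj, fun x => (r x).hom, e, fun x => (r x).cofibrant,
    fun x => (r x).trivFib, he⟩

lemma exists_section_of_isCofibrant (hA : IsCofibrant A)
    (hπ : SSet.modelCategoryQuillen.I.rlp π.hom) : ∃ σ : A.endMon a ⟶ N, σ ≫ π = 𝟙 _ := by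
  obtain ⟨P, p, e, hP, hp, he⟩ := exists_free_resolutions a π hπ
  have := hA.mem _ (trivialFibrations_resolvedFunctor π hP hp)
  have sq : CommSq (Limits.initial.to (resolved π P p)) (Limits.initial.to A)
    (resolvedFunctor π P p) (𝟙 A) := ⟨Limits.initialIsInitial.hom_ext _ _⟩
  obtain ⟨g, hg⟩ := exists_section_endMap sq.fac_right (fun _ _ h => h) a
  exact ⟨g ≫ resolvedEndHom π e, (Category.assoc g (resolvedEndHom π e) π).trans
    ((congrArg (g ≫ ·) (resolvedEndHom_comp π e he)).trans hg)⟩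

end SCat

theorem lemma2p4 (A : SCat.{u}) (hA : IsCofibrant A) (a : A) : IsCofibrant (A.endMon a) := by
  refine ⟨fun Q R q hq => ⟨fun {f g} sq => ?_⟩⟩
  have hq' : SSet.modelCategoryQuillen.I.rlp ((Mon.forget SSet.{u}).map q) := by
    rw [← SSet.trivialFibrations_eq]
    exact hq
  -- The forgetful functor preserves pullbacks, so the base change of `q` along `g` is again a
  -- trivial fibration.
  have hπ : SSet.modelCategoryQuillen.I.rlp (Limits.pullback.snd q g).hom :=
    MorphismProperty.of_isPullback ((IsPullback.of_hasPullback q g).map (Mon.forget SSet.{u})) hq'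
  obtain ⟨σ, hσ⟩ := SCat.exists_section_of_isCofibrant _ hA hπ
  -- The upper triangle commutes automatically because its source is initial.
  refine ⟨⟨⟨σ ≫ Limits.pullback.fst q g, Limits.initialIsInitial.hom_ext _ _, ?_⟩⟩⟩
  rw [Category.assoc, Limits.pullback.condition, reassoc_of% hσ]
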